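/- **Theorem 5.2.** For $n\in\mathbb{Z}$ let $[n]_q=\frac{1-q^n}{1-q}\in\mathbb{Z}(q)$. Let $x\mapsto[x]_q$ be the quantization map $\mathbb{Q}\cup\{\infty\}\to\mathbb{Z}(q)\cup\{\infty\}$, that is, the unique map with $[0]_q=0$ such that, for all $x\in\mathbb{Q}\cup\{\infty\}$, $$[x+1]_q=q\,[x]_q+1,\qquad \left[-\frac1x\right]_q=-\frac{1}{q\,[x]_q}.$$ Equivalently, $[\infty]_q=\infty$, and if $x=c_0-\cfrac{1}{c_1-\cfrac{1}{\ddots-\cfrac{1}{c_\ell}}}$ with $c_0\in\mathbb{Z}$ and integers $c_1,\dots,c_\ell\ge 2$, then $$[x]_q=[c_0]_q-\cfrac{q^{c_0-1}}{[c_1]_q-\cfrac{q^{c_1-1}}{\ddots-\cfrac{q^{c_{\ell-1}-1}}{[c_\ell]_q}}}.$$ Call a polynomial $P(q)=\sum_{i\ge0}a_iq^i\in\mathbb{Z}[q]$ (with $a_i=0$ for $i>\deg P$) *unimodal* if there is an index $k$ with $a_0\le a_1\le\dots\le a_k\ge a_{k+1}\ge a_{k+2}\ge\cdots$. Let $x\in\mathbb{Q}\cup\{\infty\}$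 and write $[x]_q=\frac{\mathcal N(q)}{\mathcal M(q)}$ with $\mathcal N,\mathcal M\in\mathbb{Z}[q]$ without common non-unit factor in $\mathbb{Z}[q]$, the common sign of $\mathcal N,\mathcal M$ being fixed by requiring that $\mathcal M$ has positive leading coefficient (and $\mathcal N=1$, $\mathcal M=0$ if $x=\infty$). Then $\mathcal M$ is unimodal; if $x\ge0$ or $x=\infty$, then $\mathcal N$ is unimodal; and if $x<0$, then $-\mathcal N$ is unimodal. -/

import Mathlib

open Polynomial

noncomputable section

namespace QRational

/-- The field `ℤ(q)` of rational functions. -/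
abbrev Zq : Type := RatFunc ℤ

/-- The formal variable `q`. -/
def q : Zq := RatFunc.X

/-- The `q`-integer `[n]_q = (1 - q ^ n) / (1 - q)`, for `n` of any sign. -/
def qInt (n : ℤ) : Zq := (1 - q ^ n) / (1 - q)

theorem den_tail_lt (x : ℚ) (h : x ≠ (⌈x⌉ : ℚ)) : (1 / ((⌈x⌉ : ℚ) - x)).den < x.den := by
  have h1 : x < (⌈x⌉ : ℚ) := lt_of_le_of_ne (Int.le_ceil x) h
  have h2 : (⌈x⌉ : ℚ) < x + 1 := Int.ceil_lt_add_one x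
  set c := ⌈x⌉
  set y : ℚ := (c : ℚ) - x with hy
  have hy0 : 0 < y := by linarith
  have hy1 : y < 1 := by linarith
  have hden : y.den = x.den := by
    have : y = -(x - (c : ℚ)) := by ring
    rw [this, Rat.den_neg_eq_den, Rat.sub_intCast_den]
  have hnum : 0 < y.num := Rat.num_pos.2 hy0
  have hlt : y.num < y.den := Rat.num_lt_denom_iff.2 hy1
  rw [one_div, Rat.den_inv_of_ne_zero hy0.ne']
  omega

/-- The `q`-deformation of a rational number, through the expansion
`x = c₀ - 1 / (c₁ - 1 / (c₂ - ⋯))` with `cᵢ ≥ 2` for `i ≥ 1`, i.e. `c₀ = ⌈x⌉` and the tail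
`⟦c₁, c₂, …⟧` is `1 / (⌈x⌉ - x)`:
`[c₀]_q` if `x = c₀`, and `[c₀]_q - q ^ (c₀ - 1) / [⟦c₁, c₂, …⟧]_q` otherwise. -/
def qRatFin (x : ℚ) : Zq :=
  if _h : x = (⌈x⌉ : ℚ) then qInt ⌈x⌉
  else qInt ⌈x⌉ - q ^ (⌈x⌉ - 1) / qRatFin (1 / ((⌈x⌉ : ℚ) - x))
termination_by x.den
decreasing_by exact den_tail_lt x _h

/-- The quantization map `ℚ ∪ {∞} → ℤ(q) ∪ {∞}`, with `[∞]_q = ∞`. -/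
def qRat : OnePoint ℚ → OnePoint Zq := OnePoint.map qRatFin

theorem q_eq : q = algebraMap ℤ[X] Zq X := RatFunc.algebraMap_X.symm

theorem q_ne_zero : q ≠ 0 := by
  rw [q_eq]; exact RatFunc.algebraMap_ne_zero X_ne_zero

theorem one_sub_q_ne_zero : (1 - q : Zq) ≠ 0 := by
  have h : (1 - X : ℤ[X]) ≠ 0 := fun h => by
    have := congrArg (Polynomial.eval 0) h
    simp at this
  have := RatFunc.algebraMap_ne_zero h
  simpa [q_eq] using this

theorem qInt_add_one (n : ℤ) : qInt (n + 1) = q * qInt n + 1 := by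
  have := one_sub_q_ne_zero
  have := q_ne_zero
  unfold qInt
  rw [zpow_add_one₀ q_ne_zero]
  field_simp
  ring

theorem qInt_zero : qInt 0 = 0 := by simp [qInt]

theorem qInt_one : qInt 1 = 1 := by simpa [qInt_zero] using qInt_add_one 0

theorem qRatFin_int (n : ℤ) : qRatFin n = qInt n := by
  rw [qRatFin]; simp

theorem qRatFin_tail (x : ℚ) (h : x ≠ (⌈x⌉ : ℚ)) :
    qRatFin x = qInt ⌈x⌉ - q ^ (⌈x⌉ - 1) / qRatFin (1 / ((⌈x⌉ : ℚ) - x)) := by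
  rw [qRatFin, dif_neg h]

/-- `[x + 1]_q = q [x]_q + 1`. -/
theorem qRatFin_add_one (x : ℚ) : qRatFin (x + 1) = q * qRatFin x + 1 := by
  have hc : ⌈x + 1⌉ = ⌈x⌉ + 1 := Int.ceil_add_one x
  by_cases h : x = (⌈x⌉ : ℚ)
  · rw [h]
    have := qRatFin_int (⌈x⌉ + 1)
    push_cast at this
    rw [this, qRatFin_int, qInt_add_one]
  · rw [qRatFin_tail x h, qRatFin_tail (x + 1), hc, qInt_add_one]
    · have e : (((⌈x⌉ + 1 : ℤ) : ℚ) - (x + 1)) = (⌈x⌉ : ℚ) - x := by push_cast; ring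
      rw [e, show ⌈x⌉ + 1 - 1 = (⌈x⌉ - 1) + 1 by ring, zpow_add_one₀ q_ne_zero]
      ring
    · rw [hc]; push_cast
      intro h'; exact h (by linarith)

theorem qRatFin_sub_one (x : ℚ) : qRatFin x = q * qRatFin (x - 1) + 1 := by
  simpa using qRatFin_add_one (x - 1)

theorem exists_qInt_eq (n : ℕ) (hn : 1 ≤ n) :
    ∃ a : ℤ[X], a.eval 0 = 1 ∧ qInt n = algebraMap ℤ[X] Zq a := by
  induction n, hn using Nat.le_induction with
  | base => exact ⟨1, by simp, by simp [qInt_one]⟩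
  | succ n _ ih =>
    obtain ⟨a, _, ha⟩ := ih
    refine ⟨X * a + 1, by simp, ?_⟩
    rw [Nat.cast_succ, qInt_add_one, ha, q_eq, map_add, map_mul, map_one]

theorem exists_frac (x : ℚ) (hx : 1 ≤ x) : ∃ a b : ℤ[X], a.eval 0 = 1 ∧ b.eval 0 = 1 ∧
    qRatFin x = algebraMap ℤ[X] Zq a / algebraMap ℤ[X] Zq b := by
  induction hn : x.den using Nat.strong_induction_on generalizing x with
  | _ n ih =>
  have hc1 : 1 ≤ ⌈x⌉ := by
    have : (0 : ℤ) < ⌈x⌉ := Int.ceil_pos.2 (by linarith)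
    omega
  by_cases h : x = (⌈x⌉ : ℚ)
  · obtain ⟨k, hk⟩ := Int.eq_ofNat_of_zero_le (by omega : 0 ≤ ⌈x⌉)
    obtain ⟨a, ha, e⟩ := exists_qInt_eq k (by omega)
    refine ⟨a, 1, ha, by simp, ?_⟩
    rw [h, qRatFin_int, hk]
    simpa using e
  · have h1 : x < (⌈x⌉ : ℚ) := lt_of_le_of_ne (Int.le_ceil x) h
    have h2 : (⌈x⌉ : ℚ) < x + 1 := Int.ceil_lt_add_one x
    have hc2 : 2 ≤ ⌈x⌉ := by
      have : (1 : ℚ) < (⌈x⌉ : ℚ) := by linarith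
      have : (1 : ℤ) < ⌈x⌉ := by exact_mod_cast this
      omega
    obtain ⟨k, hk⟩ := Int.eq_ofNat_of_zero_le (by omega : 0 ≤ ⌈x⌉ - 2)
    obtain ⟨p, hp, ep⟩ := exists_qInt_eq (k + 2) (by omega)
    have hy : 1 ≤ 1 / ((⌈x⌉ : ℚ) - x) := by
      rw [le_div_iff₀ (by linarith)]; linarith
    obtain ⟨a, b, ha, hb, e⟩ := ih _ (hn ▸ den_tail_lt x h) _ hy rfl
    have ha0 : algebraMap ℤ[X] Zq a ≠ 0 := RatFunc.algebraMap_ne_zero (by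
      rintro rfl; simp at ha)
    refine ⟨p * a - X ^ (k + 1) * b, a, by simp [hp, ha], ha, ?_⟩
    rw [qRatFin_tail x h, e, show ⌈x⌉ = ((k + 2 : ℕ) : ℤ) by push_cast; omega, ep,
      show (((k + 2 : ℕ) : ℤ) - 1) = ((k + 1 : ℕ) : ℤ) by push_cast; ring, zpow_natCast, q_eq]
    simp only [map_sub, map_mul, map_pow]
    field_simp

theorem qRatFin_ne_zero_of_one_le (x : ℚ) (hx : 1 ≤ x) : qRatFin x ≠ 0 := by
  obtain ⟨a, b, ha, hb, e⟩ := exists_frac x hx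
  rw [e]
  refine div_ne_zero (RatFunc.algebraMap_ne_zero ?_) (RatFunc.algebraMap_ne_zero ?_)
  · rintro rfl; simp at ha
  · rintro rfl; simp at hb

theorem qRatFin_zero : qRatFin 0 = 0 := by simpa [qInt_zero] using qRatFin_int 0

theorem qRatFin_one : qRatFin 1 = 1 := by simpa [qInt_one] using qRatFin_int 1

/-- The statement that `[x]_q ≠ 0` and `[-1 / x]_q = -1 / (q [x]_q)`. -/
def SOk (x : ℚ) : Prop := qRatFin x ≠ 0 ∧ qRatFin (-1 / x) = -1 / (q * qRatFin x)

theorem SOk.neg_inv {x : ℚ} (h : SOk x) : SOk (-1 / x) := by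
  obtain ⟨h0, h1⟩ := h
  have hq := q_ne_zero
  refine ⟨by rw [h1]; exact div_ne_zero (by simp) (mul_ne_zero hq h0), ?_⟩
  have : -1 / (-1 / x) = x := by
    by_cases hx : x = 0
    · simp [hx]
    · field_simp
  rw [this, h1]
  field_simp

theorem sOk_of_one_le (x : ℚ) (hx : 1 ≤ x) : SOk x := by
  have hq := q_ne_zero
  refine ⟨qRatFin_ne_zero_of_one_le x hx, ?_⟩
  rcases hx.eq_or_lt with rfl | hx
  · have := qRatFin_sub_one 0
    rw [qRatFin_zero] at this
    rw [qRatFin_one, show (-1 / 1 : ℚ) = 0 - 1 by norm_num]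
    field_simp
    linear_combination -this
  · have hc : ⌈-1 / x⌉ = 0 := by
      rw [Int.ceil_eq_zero_iff]
      constructor
      · rw [lt_div_iff₀ (by linarith)]; linarith
      · exact div_nonpos_of_nonpos_of_nonneg (by norm_num) (by linarith)
    rw [qRatFin_tail, hc, qInt_zero]
    · have : (1 / (((0 : ℤ) : ℚ) - -1 / x)) = x := by
        have : x ≠ 0 := by linarith
        push_cast; field_simp; simp
      rw [this, zero_sub, zero_sub, zpow_neg_one]
      have := qRatFin_ne_zero_of_one_le x hx.le
      field_simp
    · rw [hc]
      have : x ≠ 0 := by linarith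
      simp [this]

theorem sOk_of_pos (x : ℚ) (hx : 0 < x) : SOk x := by
  induction hn : x.den using Nat.strong_induction_on generalizing x with
  | _ n ih =>
  rcases le_or_gt 1 x with h1 | h1
  · exact sOk_of_one_le x h1
  have hq := q_ne_zero
  have hc : ⌈x⌉ = 1 := by
    rw [Int.ceil_eq_iff]; constructor <;> push_cast <;> linarith
  have hne : x ≠ (⌈x⌉ : ℚ) := by rw [hc]; push_cast; linarith
  have hden := den_tail_lt x hne
  have hx1 := qRatFin_tail x hne
  rw [hc] at hden hx1
  rw [qInt_one, sub_self, zpow_zero, Int.cast_one] at hx1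
  rw [Int.cast_one] at hden
  have hpos : 0 < 1 - x := by linarith
  set z : ℚ := 1 / (1 - x) with hz
  have hz1 : 0 < z - 1 := by
    have : z - 1 = x / (1 - x) := by rw [hz]; field_simp; ring
    rw [this]; positivity
  have hzden : (z - 1).den = z.den := by
    simp
  obtain ⟨w0, w1⟩ := ih _ (by rw [hzden, ← hn]; exact hden) (z - 1) hz1 rfl
  have hzw := qRatFin_sub_one z
  have hz0 : qRatFin z ≠ 0 := qRatFin_ne_zero_of_one_le z (by linarith)
  have hx0 : qRatFin x ≠ 0 := by
    have : qRatFin x = q * qRatFin (z - 1) / qRatFin z := by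
      rw [hx1]; field_simp; rw [hzw]; ring
    rw [this]
    exact div_ne_zero (mul_ne_zero hq w0) hz0
  refine ⟨hx0, ?_⟩
  have hs := qRatFin_sub_one (-1 / (z - 1))
  have e : -1 / (z - 1) - 1 = -1 / x := by
    have : z - 1 = x / (1 - x) := by rw [hz]; field_simp; ring
    rw [this]
    field_simp
    ring
  rw [e, w1] at hs
  have hx2 : q * qRatFin x * qRatFin z = q * (q * qRatFin (z - 1)) := by
    rw [hx1]; field_simp; rw [hzw]; ring
  have hs2 : q * qRatFin (-1 / x) = -1 / (q * qRatFin (z - 1)) - 1 := by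
    linear_combination -hs
  have hs3 : q * (q * qRatFin (z - 1)) * qRatFin (-1 / x) = - qRatFin z := by
    have : q * (q * qRatFin (z - 1)) * qRatFin (-1 / x)
      = (q * qRatFin (z - 1)) * (q * qRatFin (-1 / x)) := by ring
    rw [this, hs2, hzw]
    field_simp
    ring
  rw [eq_div_iff (mul_ne_zero hq hx0)]
  apply mul_right_cancel₀ hz0
  calc qRatFin (-1 / x) * (q * qRatFin x) * qRatFin z
      = qRatFin (-1 / x) * (q * qRatFin x * qRatFin z) := by ring
    _ = -1 * qRatFin z := by rw [hx2]; linear_combination hs3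

theorem sOk (x : ℚ) (hx : x ≠ 0) : SOk x := by
  rcases lt_or_gt_of_ne hx with h | h
  · have := (sOk_of_pos (-1 / x) (div_pos_of_neg_of_neg (by norm_num) h)).neg_inv
    rwa [show -1 / (-1 / x) = x by field_simp] at this
  · exact sOk_of_pos x h

/-- The transformation `y ↦ a y + 1` of the projective line over a field. For `a = 1` this is the
generator `T` of `PSL(2, ℤ)`, for `a = q` its deformation `T_q`. -/
def actT {K : Type} [Field K] (a : K) : OnePoint K → OnePoint K := OnePoint.map fun y => a * y + 1

open scoped Classical in
/-- The transformation `y ↦ -1 / (a y)` of the projective line over a field. For `a = 1` this is the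
generator `S` of `PSL(2, ℤ)`, for `a = q` its deformation `S_q`. -/
def actS {K : Type} [Field K] (a : K) : OnePoint K → OnePoint K
  | none => ((0 : K) : OnePoint K)
  | some y =>
      if y = 0 then OnePoint.infty else ((-1 / (a * y) : K) : OnePoint K)

theorem actS_zero {K : Type} [Field K] (a : K) :
    actS a ((0 : K) : OnePoint K) = OnePoint.infty := by
  classical exact if_pos rfl

theorem actS_coe {K : Type} [Field K] (a : K) {y : K} (hy : y ≠ 0) :
    actS a (y : OnePoint K) = ((-1 / (a * y) : K) : OnePoint K) := by
  classical exact if_neg hy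

/-- `f` sends `0` to `0` and commutes with the two actions of `PSL(2, ℤ)`. -/
structure IsQuantization (f : OnePoint ℚ → OnePoint Zq) : Prop where
  map_zero : f ((0 : ℚ) : OnePoint ℚ) = ((0 : Zq) : OnePoint Zq)
  map_T : ∀ x, f (actT 1 x) = actT q (f x)
  map_S : ∀ x, f (actS 1 x) = actS q (f x)

/-- The explicit formula is a quantization map. -/
theorem isQuantization_qRat : IsQuantization qRat where
  map_zero := by
    change ((qRatFin 0 : Zq) : OnePoint Zq) = _
    rw [qRatFin_zero]
  map_T x := by
    cases x using OnePoint.rec with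
    | infty => rfl
    | coe x =>
      change ((qRatFin (1 * x + 1) : Zq) : OnePoint Zq) = ((q * qRatFin x + 1 : Zq) : OnePoint Zq)
      rw [one_mul, qRatFin_add_one]
  map_S x := by
    cases x using OnePoint.rec with
    | infty =>
      change ((qRatFin 0 : Zq) : OnePoint Zq) = ((0 : Zq) : OnePoint Zq)
      rw [qRatFin_zero]
    | coe x =>
      by_cases hx : x = 0
      · subst hx
        have h0 : qRat ((0 : ℚ) : OnePoint ℚ) = ((0 : Zq) : OnePoint Zq) := by
          change ((qRatFin 0 : Zq) : OnePoint Zq) = _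
          rw [qRatFin_zero]
        rw [h0, actS_zero, actS_zero]; rfl
      · obtain ⟨h0, h1⟩ := sOk x hx
        change _ = actS q ((qRatFin x : Zq) : OnePoint Zq)
        rw [actS_coe _ hx, actS_coe _ h0, ← h1, one_mul]; rfl

theorem actT_injective {K : Type} [Field K] {a : K} (ha : a ≠ 0) :
    Function.Injective (actT a) := by
  intro x y h
  cases x using OnePoint.rec <;> cases y using OnePoint.rec
  · rfl
  · exact absurd h (OnePoint.infty_ne_coe _)
  · exact absurd h (OnePoint.coe_ne_infty _)
  · have h' := OnePoint.coe_injective h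
    simp only [add_left_inj, mul_eq_mul_left_iff, ha, or_false] at h'
    rw [h']

/-- The quantization map is unique. -/
theorem IsQuantization.eq_qRat {f : OnePoint ℚ → OnePoint Zq} (hf : IsQuantization f) :
    f = qRat := by
  have hg := isQuantization_qRat
  have hT : ∀ x : ℚ, f x = qRat x ↔ f ((x + 1 : ℚ) : OnePoint ℚ) = qRat ((x + 1 : ℚ)) := by
    intro x
    have e : ((x + 1 : ℚ) : OnePoint ℚ) = actT 1 (x : OnePoint ℚ) := by
      change _ = ((1 * x + 1 : ℚ) : OnePoint ℚ); rw [one_mul]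
    rw [e, hf.map_T, hg.map_T, (actT_injective q_ne_zero).eq_iff]
  have hTn : ∀ (n : ℤ) (x : ℚ), f x = qRat x ↔ f ((x + n : ℚ) : OnePoint ℚ) = qRat ((x + n : ℚ)) := by
    intro n x
    induction n using Int.induction_on with
    | zero => simp
    | succ n ih =>
      rw [ih, hT]; push_cast; rw [add_assoc]
    | pred n ih =>
      rw [ih, hT (x + ((-n - 1 : ℤ) : ℚ))]
      have : x + ((-n - 1 : ℤ) : ℚ) + 1 = x + ((-n : ℤ) : ℚ) := by push_cast; ring
      rw [this]
  have h0 : f ((0 : ℚ) : OnePoint ℚ) = qRat ((0 : ℚ) : OnePoint ℚ) := by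
    rw [hf.map_zero, hg.map_zero]
  have key : ∀ x : ℚ, f x = qRat x := by
    intro x
    induction hn : x.den using Nat.strong_induction_on generalizing x with
    | _ n ih =>
    by_cases h : x = (⌈x⌉ : ℚ)
    · rw [h]
      have := (hTn ⌈x⌉ 0).1 h0
      rwa [zero_add] at this
    · have h1 : x < (⌈x⌉ : ℚ) := lt_of_le_of_ne (Int.le_ceil x) h
      have hy := ih _ (hn ▸ den_tail_lt x h) _ rfl
      rw [hTn (-⌈x⌉) x]
      set y : ℚ := 1 / ((⌈x⌉ : ℚ) - x) with hyd
      have hy0 : y ≠ 0 := by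
        rw [hyd]; exact one_div_ne_zero (by linarith)
      have e : ((x + ((-⌈x⌉ : ℤ) : ℚ) : ℚ) : OnePoint ℚ) = actS 1 (y : OnePoint ℚ) := by
        rw [actS_coe _ hy0]
        congr 1
        rw [hyd]; push_cast; field_simp; ring
      rw [e, hf.map_S, hg.map_S, hy]
  funext x
  cases x using OnePoint.rec with
  | coe x => exact key x
  | infty =>
    rw [← actS_zero (1 : ℚ), hf.map_S, hg.map_S, h0]

/-- `N / M` is the expression of an element of `ℤ(q) ∪ {∞}` in lowest terms over `ℤ[q]`, with `∞`
expressed as `1 / 0`. The leading coefficient of a nonzero denominator is taken to be positive,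
which fixes the common sign of `N` and `M`. -/
structure IsReducedFraction (f : OnePoint Zq) (N M : ℤ[X]) : Prop where
  isRelPrime : IsRelPrime N M
  eq_div : M ≠ 0 → f = ((algebraMap ℤ[X] Zq N / algebraMap ℤ[X] Zq M : Zq) : OnePoint Zq)
  eq_infty : M = 0 → f = OnePoint.infty
  sign : 0 < M.leadingCoeff ∨ M = 0 ∧ N = 1

/-- The sequence of coefficients (extended by zeros beyond the degree) increases weakly up to some
index and decreases weakly from there on. -/
def IsUnimodal (P : ℤ[X]) : Prop :=
  ∃ k : ℕ, MonotoneOn P.coeff (Set.Iic k) ∧ AntitoneOn P.coeff (Set.Ici k)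

end QRational

end

open Polynomial

noncomputable section

namespace QRational

/-! Up to powers of `X` and sign, the numerator and denominator of a nonzero `q`-rational are 1 or
rank polynomials R_w, where w is a word in the generators y ↦ qy + 1 and y ↦ qy/(qy + 1): the
Euclidean algorithm gives the positive rationals, and [-1/x]_q = -1/(q[x]_q) gives the negative
ones.

Let m = |w| + 1 be the degree of R_w and r_i its coefficients. For j < l, it is enough that r_j ≤
r_l whenever j + l = m - 1, that r_j ≥ r_l whenever j + l = m + 1, and that one of the two
directions holds throughout j + l = m. Two adjacent reflections compose to a shift by one, so
consecutive coefficients become comparable (`exists_mode`). Exchanging the letters of w reverses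
R_w, so these are sign conditions on the lower half of R_{swap w} - q^a R_w, for a = 1
(`IsRightHeavy`) and a = 0 (`IsOneSided`).

Both are proved together by induction on |w|. Equal end letters can be removed
(`rankPoly_sub_swap_same`); distinct end letters lead to a shorter word with some a ≥ 1
(`rankPoly_sub_swap_ne`); the case a = 1 is handled by rotating the word
(`rankPoly_swap_sub_rotate`). The cases a > 1 follow from a = 1 together with unimodality, which
closes the induction. -/

/-! ### Coefficient sequences over ℤ, and unimodality from reflections. -/

/-- The coefficients of a polynomial, extended by zero to negative indices. -/
def intCoeff (p : ℤ[X]) (i : ℤ) : ℤ := if 0 ≤ i then p.coeff i.toNat else 0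

theorem intCoeff_natCast (p : ℤ[X]) (i : ℕ) : intCoeff p i = p.coeff i := by simp [intCoeff]

theorem intCoeff_add (p r : ℤ[X]) (i : ℤ) : intCoeff (p + r) i = intCoeff p i + intCoeff r i := by
  unfold intCoeff; split <;> simp

theorem intCoeff_sub (p r : ℤ[X]) (i : ℤ) : intCoeff (p - r) i = intCoeff p i - intCoeff r i := by
  unfold intCoeff; split <;> simp

theorem intCoeff_X_mul (p : ℤ[X]) (i : ℤ) : intCoeff (X * p) i = intCoeff p (i - 1) := by
  rcases lt_trichotomy i 0 with h | rfl | h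
  · rw [intCoeff, intCoeff, if_neg (by omega), if_neg (by omega)]
  · simp [intCoeff]
  · obtain ⟨n, rfl⟩ : ∃ n : ℕ, i = ((n + 1 : ℕ) : ℤ) := ⟨(i - 1).toNat, by omega⟩
    rw [intCoeff_natCast, show ((n + 1 : ℕ) : ℤ) - 1 = n by push_cast; ring, intCoeff_natCast,
      coeff_X_mul]

theorem intCoeff_X_pow_mul (a : ℕ) (p : ℤ[X]) (i : ℤ) :
    intCoeff (X ^ a * p) i = intCoeff p (i - a) := by
  induction a generalizing i with
  | zero => simp
  | succ a ih =>
    rw [pow_succ', mul_assoc, intCoeff_X_mul, ih]; congr 1; push_cast; ring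

theorem intCoeff_one (i : ℤ) : intCoeff 1 i = if i = 0 then 1 else 0 := by
  unfold intCoeff
  rw [coeff_one]
  split_ifs <;> omega

theorem isUnimodal_of_intCoeff {p : ℤ[X]} {k : ℤ} (hup : ∀ i < k, intCoeff p i ≤ intCoeff p (i + 1))
    (hdown : ∀ i, k ≤ i → intCoeff p (i + 1) ≤ intCoeff p i) : IsUnimodal p := by
  refine ⟨k.toNat, ?_, ?_⟩
  · refine monotoneOn_of_le_add_one Set.ordConnected_Iic fun i _ _ hi => ?_
    simp only [Set.mem_Iic] at hi
    simpa [← intCoeff_natCast] using hup i (by omega)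
  · refine antitoneOn_of_add_one_le Set.ordConnected_Ici fun i _ hi _ => ?_
    simp only [Set.mem_Ici] at hi
    simpa [← intCoeff_natCast] using hdown i (by omega)

theorem le_of_step_le {f : ℤ → ℤ} {k : ℤ} (h : ∀ i < k, f i ≤ f (i + 1)) {j l : ℤ} (hjl : j ≤ l)
    (hl : l ≤ k) : f j ≤ f l := by
  induction l, hjl using Int.leInduction with
  | base => exact le_rfl
  | succ l _ ih => exact (ih (by omega)).trans (h l (by omega))

theorem le_of_le_step {f : ℤ → ℤ} {k : ℤ} (h : ∀ i, k ≤ i → f (i + 1) ≤ f i) {j l : ℤ}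
    (hjl : j ≤ l) (hj : k ≤ j) : f l ≤ f j := by
  induction l, hjl using Int.leInduction with
  | base => exact le_rfl
  | succ l _ ih => exact (h l (by omega)).trans ih

/-- A sequence comparing in a fixed direction with its reflections in `(m - 1) / 2` and
`(m + 1) / 2`, and in either direction with its reflection in `m / 2`, is unimodal. -/
theorem exists_mode {f : ℤ → ℤ} {m : ℤ} (h₁ : ∀ j l, j + l = m - 1 → j < l → f j ≤ f l)
    (h₂ : ∀ j l, j + l = m + 1 → j < l → f l ≤ f j)
    (h₃ : (∀ j l, j + l = m → j < l → f j ≤ f l) ∨ (∀ j l, j + l = m → j < l → f l ≤ f j)) :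
    ∃ k : ℤ, (∀ i < k, f i ≤ f (i + 1)) ∧ (∀ i, k ≤ i → f (i + 1) ≤ f i) := by
  rcases h₃ with h₃ | h₃
  -- Each comparison of i with i + 1 passes through m - i, its reflection for `h₃`; when one
  -- reflection already exchanges i and i + 1, it suffices alone.
  · refine ⟨(m + 1) / 2, fun i hi => ?_, fun i hi => ?_⟩
    · rcases eq_or_ne (2 * i + 1) m with h | h
      · exact h₃ i (i + 1) (by omega) (by omega)
      · exact (h₃ i (m - i) (by omega) (by omega)).trans
          (by
            rcases eq_or_ne (m - i) (i + 1) with e | e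
            · rw [e]
            · exact h₂ (i + 1) (m - i) (by omega) (by omega))
    · rcases eq_or_ne (2 * i) m with h | h
      · exact h₂ i (i + 1) (by omega) (by omega)
      · exact (h₂ (m - i) (i + 1) (by omega) (by omega)).trans
          (h₃ (m - i) i (by omega) (by omega))
  · refine ⟨m / 2, fun i hi => ?_, fun i hi => ?_⟩
    · rcases eq_or_ne (2 * i + 2) m with h | h
      · exact h₁ i (i + 1) (by omega) (by omega)
      · exact (h₁ i (m - 1 - i) (by omega) (by omega)).trans
          (h₃ (i + 1) (m - 1 - i) (by omega) (by omega))
    · rcases eq_or_ne (2 * i + 1) m with h | h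
      · exact h₃ i (i + 1) (by omega) (by omega)
      · exact (h₃ (m - 1 - i) (i + 1) (by omega) (by omega)).trans
          (by
            rcases eq_or_ne (m - 1 - i) i with e | e
            · rw [e]
            · exact h₁ (m - 1 - i) i (by omega) (by omega))

/-! ### Words, their matrices and rank polynomials. -/

/-- The `q`-deformed generators `y ↦ q y + 1` (for `true`) and `y ↦ q y / (q y + 1)` (for `false`)
of the positive rationals. -/
def step : Bool → Matrix (Fin 2) (Fin 2) ℤ[X]
  | true => !![X, 1; 0, 1]
  | false => !![X, 0; X, 1]

/-- The product of the generators along a word. -/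
def wordMat (w : List Bool) : Matrix (Fin 2) (Fin 2) ℤ[X] := (w.map step).prod

/-- The word with the two letters exchanged. -/
def swap (w : List Bool) : List Bool := w.map not

/-- The rank generating polynomial of the lattice of order ideals of the fence poset on
`w.length + 1` elements whose relations are given by `w`. -/
def rankPoly (w : List Bool) : ℤ[X] :=
  X * wordMat w 0 0 + X * wordMat w 0 1 + wordMat w 1 0 + wordMat w 1 1

@[simp] theorem swap_nil : swap [] = [] := rfl
@[simp] theorem swap_cons (x : Bool) (w : List Bool) : swap (x :: w) = (!x) :: swap w := rfl
@[simp] theorem swap_append (v w : List Bool) : swap (v ++ w) = swap v ++ swap w := by simp [swap]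
@[simp] theorem swap_swap (w : List Bool) : swap (swap w) = w := by simp [swap, Function.comp_def]
@[simp] theorem length_swap (w : List Bool) : (swap w).length = w.length := by simp [swap]
@[simp] theorem swap_replicate (a : ℕ) (x : Bool) :
    swap (List.replicate a x) = List.replicate a !x := by simp [swap]

theorem wordMat_cons (x : Bool) (w : List Bool) : wordMat (x :: w) = step x * wordMat w := by
  simp [wordMat]

theorem wordMat_append (v w : List Bool) : wordMat (v ++ w) = wordMat v * wordMat w := by
  simp [wordMat]

theorem wordMat_nil : wordMat [] = 1 := rfl

/-- The intertwining matrix deforms the exchange y ↦ 1/y, to which it specializes at q = 1. It is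
enough to check it on each generator. -/
theorem wordMat_mul_conj (w : List Bool) :
    wordMat w * !![X - 1, 1; X, 1 - X] = !![X - 1, 1; X, 1 - X] * wordMat (swap w) := by
  induction w with
  | nil => simp [wordMat]
  | cons x w ih =>
    rw [swap_cons, wordMat_cons, wordMat_cons, mul_assoc, ih, ← mul_assoc, ← mul_assoc]
    congr 1
    cases x <;>
    · refine Matrix.ext fun i j => ?_
      fin_cases i <;> fin_cases j <;> simp [step, Matrix.mul_apply, Fin.sum_univ_two] <;> ring

/-- The four relations between the entries of the matrices of a word and of its swap. -/
theorem entries_swap (w : List Bool) :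
    (X - 1) * wordMat w 0 0 + X * wordMat w 0 1
        = (X - 1) * wordMat (swap w) 0 0 + wordMat (swap w) 1 0 ∧
    wordMat w 0 0 + (1 - X) * wordMat w 0 1
        = (X - 1) * wordMat (swap w) 0 1 + wordMat (swap w) 1 1 ∧
    (X - 1) * wordMat w 1 0 + X * wordMat w 1 1
        = X * wordMat (swap w) 0 0 + (1 - X) * wordMat (swap w) 1 0 ∧
    wordMat w 1 0 + (1 - X) * wordMat w 1 1
        = X * wordMat (swap w) 0 1 + (1 - X) * wordMat (swap w) 1 1 := by
  have h := wordMat_mul_conj w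
  have h00 := congrFun (congrFun h 0) 0
  have h01 := congrFun (congrFun h 0) 1
  have h10 := congrFun (congrFun h 1) 0
  have h11 := congrFun (congrFun h 1) 1
  simp only [Matrix.mul_apply, Fin.sum_univ_two, Matrix.of_apply, Matrix.cons_val_zero,
    Matrix.cons_val_one, Matrix.cons_val', Matrix.cons_val_fin_one] at h00 h01 h10 h11
  refine ⟨?_, ?_, ?_, ?_⟩
  · linear_combination h00
  · linear_combination h01
  · linear_combination h10
  · linear_combination h11

/-- The trace of `w` followed by `true` is that of its swap followed by `false`. -/
theorem trace_swap (w : List Bool) :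
    X * wordMat w 0 0 + wordMat w 1 0 + wordMat w 1 1
      = X * wordMat (swap w) 0 0 + X * wordMat (swap w) 0 1 + wordMat (swap w) 1 1 := by
  obtain ⟨_, h2, _, h4⟩ := entries_swap w
  obtain ⟨_, h2', _, _⟩ := entries_swap (swap w)
  rw [swap_swap] at h2'
  linear_combination X * h2 + h4 - X * h2'

/-- The trace identity cancels everything but one off-diagonal entry of each matrix, which makes
such differences easy to compute along a factorization of the word. -/
theorem rankPoly_sub_swap (w : List Bool) :
    rankPoly w - rankPoly (swap w) = X * wordMat w 0 1 - wordMat (swap w) 1 0 := by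
  have := trace_swap w
  unfold rankPoly
  linear_combination this

theorem rankPoly_sub_swap' (w : List Bool) :
    rankPoly w - rankPoly (swap w) = wordMat w 1 0 - X * wordMat (swap w) 0 1 := by
  have := rankPoly_sub_swap (swap w)
  rw [swap_swap] at this
  linear_combination -this

/-- Each generator is obtained from the other by substituting 1/q for q, multiplying by q and
exchanging the two coordinates; products inherit this with the factor q^|w|. -/
theorem intCoeff_wordMat_swap (w : List Bool) (i : ℤ) :
    intCoeff (wordMat (swap w) 0 0) i = intCoeff (wordMat w 1 1) (w.length - i) ∧
    intCoeff (wordMat (swap w) 0 1) i = intCoeff (wordMat w 1 0) (w.length - i) ∧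
    intCoeff (wordMat (swap w) 1 0) i = intCoeff (wordMat w 0 1) (w.length - i) ∧
    intCoeff (wordMat (swap w) 1 1) i = intCoeff (wordMat w 0 0) (w.length - i) := by
  induction w generalizing i with
  | nil =>
    have h0 : ∀ i, intCoeff 0 i = 0 := fun i => by simp [intCoeff]
    simp [wordMat, intCoeff_one, h0]
  | cons x w ih =>
    obtain ⟨a, b, c, d⟩ := ih i
    obtain ⟨a', b', c', d'⟩ := ih (i - 1)
    have e : (w.length : ℤ) + 1 - i - 1 = w.length - i := by ring
    have e' : (w.length : ℤ) - (i - 1) = w.length + 1 - i := by ring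
    rw [e'] at a' b' c' d'
    cases x <;>
      simp [wordMat_cons, step, Matrix.mul_apply, Fin.sum_univ_two, intCoeff_add, intCoeff_X_mul,
        c, d, a', b', e, add_comm]

/-- Passing to the dual poset reverses the rank generating polynomial. -/
theorem intCoeff_rankPoly_swap (w : List Bool) (i : ℤ) :
    intCoeff (rankPoly (swap w)) i = intCoeff (rankPoly w) (w.length + 1 - i) := by
  obtain ⟨-, -, c, d⟩ := intCoeff_wordMat_swap w i
  obtain ⟨a', b', -, -⟩ := intCoeff_wordMat_swap w (i - 1)
  simp only [rankPoly, intCoeff_add, intCoeff_X_mul, c, d, a', b']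
  rw [show (w.length : ℤ) - (i - 1) = w.length + 1 - i by ring,
    show (w.length : ℤ) + 1 - i - 1 = w.length - i by ring]
  ring

theorem rankPoly_sub_swap_same (x : Bool) (w : List Bool) :
    rankPoly (x :: (w ++ [x])) - rankPoly (swap (x :: (w ++ [x])))
      = X * (rankPoly w - rankPoly (swap w)) := by
  cases x
  · rw [rankPoly_sub_swap']
    simp [wordMat_cons, wordMat_append, wordMat_nil, step, Matrix.mul_apply, Fin.sum_univ_two,
      rankPoly]
    ring
  · rw [rankPoly_sub_swap]
    simp [wordMat_cons, wordMat_append, wordMat_nil, step, Matrix.mul_apply, Fin.sum_univ_two,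
      rankPoly]
    ring

/-! ### Runs of equal letters, and the identities that shorten or rotate a word. -/

/-- The `q`-integer as a polynomial. -/
def geom (a : ℕ) : ℤ[X] := ∑ i ∈ Finset.range a, X ^ i

theorem geom_mul (a : ℕ) : geom a * (X - 1) = X ^ a - 1 := geom_sum_mul X a

theorem geom_succ (a : ℕ) : geom (a + 1) = X * geom a + 1 := geom_sum_succ

theorem wordMat_replicate_true (a : ℕ) :
    wordMat (List.replicate a true) = !![X ^ a, geom a; 0, 1] := by
  induction a with
  | zero => simp [wordMat, geom, Matrix.one_fin_two]
  | succ a ih =>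
    rw [List.replicate_succ, wordMat_cons, ih, geom_succ]
    simp [step, pow_succ']

theorem wordMat_replicate_false (a : ℕ) :
    wordMat (List.replicate a false) = !![X ^ a, 0; X * geom a, 1] := by
  induction a with
  | zero => simp [wordMat, geom, Matrix.one_fin_two]
  | succ a ih =>
    have := geom_mul a
    rw [List.replicate_succ, wordMat_cons, ih, geom_succ]
    simp [step, pow_succ']
    linear_combination -X * this

theorem rankPoly_sub_swap_replicate (a : ℕ) :
    rankPoly (List.replicate a true ++ [false]) - rankPoly (swap (List.replicate a true ++ [false]))
      = X * (1 - X ^ a) := by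
  rw [rankPoly_sub_swap']
  simp [wordMat_append, wordMat_cons, wordMat_nil, step, Matrix.mul_apply, Fin.sum_univ_two,
    wordMat_replicate_true, wordMat_replicate_false]
  ring

theorem rankPoly_sub_swap_ne (a : ℕ) (w : List Bool) :
    rankPoly (List.replicate a true ++ false :: (w ++ [false]))
        - rankPoly (swap (List.replicate a true ++ false :: (w ++ [false])))
      = X * (rankPoly w - X ^ a * rankPoly (swap w)) := by
  rw [rankPoly_sub_swap']
  simp only [rankPoly, swap_append, swap_cons, swap_nil, swap_replicate, Bool.not_true,
    Bool.not_false, wordMat_append, wordMat_cons, wordMat_nil, Matrix.mul_apply, Fin.sum_univ_two,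
    step, wordMat_replicate_true, wordMat_replicate_false, Matrix.of_apply, Matrix.cons_val_zero,
    Matrix.cons_val_one, Matrix.cons_val', Matrix.cons_val_fin_one, mul_one]
  ring

/-- Rotation of words, letters being exchanged when they pass from one end to the other. -/
theorem rankPoly_swap_sub_rotate (w : List Bool) (b : ℕ) :
    rankPoly (swap (w ++ false :: List.replicate b true))
        - X * rankPoly (w ++ false :: List.replicate b true)
      = rankPoly (swap (true :: w)) - X ^ (b + 1) * rankPoly (true :: w) := by
  obtain ⟨h1, h2, h3, h4⟩ := entries_swap w
  obtain ⟨h1', h2', h3', h4'⟩ := entries_swap (swap w)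
  rw [swap_swap] at h1' h2' h3' h4'
  have t1 := trace_swap w
  have t2 := trace_swap (swap w)
  rw [swap_swap] at t2
  have g := geom_mul b
  simp only [rankPoly, swap_append, swap_cons, swap_replicate, Bool.not_true, Bool.not_false,
    wordMat_append, wordMat_cons, Matrix.mul_apply, Fin.sum_univ_two, step,
    wordMat_replicate_true, wordMat_replicate_false, Matrix.of_apply, Matrix.cons_val_zero,
    Matrix.cons_val_one, Matrix.cons_val', Matrix.cons_val_fin_one]
  -- Eliminating `X ^ b` leaves a polynomial identity in `geom b` and the eight matrix entries,
  -- which is a combination of the swap relations.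
  have e : (X : ℤ[X]) ^ b = geom b * (X - 1) + 1 := by rw [g]; ring
  rw [pow_succ', e]
  generalize geom b = u
  generalize wordMat w 0 0 = A at *
  generalize wordMat w 0 1 = B at *
  generalize wordMat w 1 0 = C at *
  generalize wordMat w 1 1 = D at *
  generalize wordMat (swap w) 0 0 = A' at *
  generalize wordMat (swap w) 0 1 = B' at *
  generalize wordMat (swap w) 1 0 = C' at *
  generalize wordMat (swap w) 1 1 = D' at *
  linear_combination (X - X * u) * t1 + X * t2 - X ^ 2 * u * h1

/-! ### Comparison of coefficients with their reflections: the induction. -/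

/-- In degrees below `(m + a) / 2`, with `m = w.length + 1`, the coefficients of `q ^ a` times the
rank generating polynomial are at most their mirror images. -/
def IsRightHeavy (w : List Bool) (a : ℕ) : Prop :=
  ∀ i : ℤ, 2 * i < w.length + 1 + a →
    0 ≤ intCoeff (rankPoly (swap w) - X ^ a * rankPoly w) i

/-- Degree i of the difference compares r_{i-a} with r_{m-i}, whose indices add up to m - a. -/
theorem isRightHeavy_iff {w : List Bool} {a : ℕ} : IsRightHeavy w a ↔
    ∀ j l : ℤ, j + l = w.length + 1 - a → j < l →
      intCoeff (rankPoly w) j ≤ intCoeff (rankPoly w) l := by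
  simp only [IsRightHeavy, intCoeff_sub, intCoeff_X_pow_mul, intCoeff_rankPoly_swap, sub_nonneg]
  constructor
  · intro h j l e hjl
    have := h (j + a) (by omega)
    rwa [show j + a - a = j by ring, show (w.length : ℤ) + 1 - (j + a) = l by omega] at this
  · intro h i hi
    exact h _ _ (by ring) (by omega)

theorem eq_replicate_or_prefix (x : Bool) (w : List Bool) :
    (∃ a, w = List.replicate a x) ∨ ∃ a v, w = List.replicate a x ++ (!x) :: v := by
  induction w with
  | nil => exact .inl ⟨0, rfl⟩
  | cons y w ih =>
    by_cases hy : y = x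
    · subst hy
      rcases ih with ⟨a, rfl⟩ | ⟨a, v, rfl⟩
      · exact .inl ⟨a + 1, rfl⟩
      · exact .inr ⟨a + 1, v, rfl⟩
    · exact .inr ⟨0, w, by cases x <;> cases y <;> simp_all⟩

theorem eq_replicate_or_suffix (x : Bool) (w : List Bool) :
    (∃ a, w = List.replicate a x) ∨ ∃ a v, w = v ++ (!x) :: List.replicate a x := by
  rcases eq_replicate_or_prefix x w.reverse with ⟨a, h⟩ | ⟨a, v, h⟩ <;>
    rw [List.reverse_eq_iff] at h <;> subst h
  · exact .inl ⟨a, by simp⟩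
  · exact .inr ⟨a, v.reverse, by simp⟩

theorem rankPoly_replicate_true (a : ℕ) : rankPoly (List.replicate a true) = geom (a + 2) := by
  have := geom_mul a
  rw [rankPoly, wordMat_replicate_true, geom_succ, geom_succ]
  simp
  linear_combination -X * this

theorem rankPoly_replicate_false (a : ℕ) : rankPoly (List.replicate a false) = geom (a + 2) := by
  have := geom_mul a
  rw [rankPoly, wordMat_replicate_false, geom_succ, geom_succ]
  simp
  linear_combination -X * this

theorem intCoeff_one_sub_X_pow {a : ℕ} {i : ℤ} (hi : i < a) : 0 ≤ intCoeff (1 - X ^ a) i := by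
  have := intCoeff_X_pow_mul a 1 i
  rw [mul_one] at this
  rw [intCoeff_sub, this, intCoeff_one, intCoeff_one, if_neg (by omega : i - a ≠ 0)]
  split_ifs <;> simp

/-- Rotation moves the last `false` to the front as `true` and turns the b letters `true` after it
into the exponent b + 1. For b > 0 the word gets shorter; for b = 0 the length and the exponent 1
are kept, but one `false` is lost, hence the inner induction. -/
theorem isRightHeavy_one (w : List Bool)
    (ih : ∀ v : List Bool, v.length < w.length → ∀ a, 1 ≤ a → IsRightHeavy v a) :
    IsRightHeavy w 1 := by
  induction hn : w.count false using Nat.strong_induction_on generalizing w with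
  | _ n ihn =>
  rcases eq_replicate_or_suffix true w with ⟨a, rfl⟩ | ⟨b, v, rfl⟩
  · intro i hi
    rw [swap_replicate, Bool.not_true, rankPoly_replicate_false, rankPoly_replicate_true]
    -- The only negative coefficient is in degree a + 2, outside the range considered.
    have e : geom (a + 2) - X ^ 1 * geom (a + 2) = 1 - X ^ (a + 2) := by
      linear_combination -geom_mul (a + 2)
    rw [e]
    simp only [List.length_replicate] at hi
    exact intCoeff_one_sub_X_pow (by push_cast at *; omega)
  · have key : IsRightHeavy (true :: v) (b + 1) := by
      rcases Nat.eq_zero_or_pos b with rfl | hb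
      · refine ihn _ ?_ (true :: v) (fun u hu => ih u (by simpa using hu)) rfl
        rw [← hn]; simp
      · exact ih _ (by simp; omega) _ (by omega)
    intro i hi
    rw [pow_one, Bool.not_true, rankPoly_swap_sub_rotate]
    apply key
    simp at hi ⊢
    linarith

/-- The coefficients in degrees below `m / 2`, with `m = w.length + 1`, compare in a fixed
direction with their mirror images. -/
def IsOneSided (w : List Bool) : Prop := IsRightHeavy w 0 ∨ IsRightHeavy (swap w) 0

theorem IsOneSided.swap {w : List Bool} (h : IsOneSided (swap w)) : IsOneSided w := by
  unfold IsOneSided at *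
  rw [swap_swap] at h
  exact h.symm

theorem isOneSided_cons_concat (x : Bool) {w : List Bool} (h : IsOneSided w) :
    IsOneSided (x :: (w ++ [x])) := by
  have e := rankPoly_sub_swap_same x w
  refine h.imp (fun h i hi => ?_) (fun h i hi => ?_)
  · have := h (i - 1) (by simp at hi ⊢; linarith)
    rw [pow_zero, one_mul] at this ⊢
    rw [show rankPoly (QRational.swap (x :: (w ++ [x]))) - rankPoly (x :: (w ++ [x]))
      = X * (rankPoly (QRational.swap w) - rankPoly w) by linear_combination -e, intCoeff_X_mul]
    exact this
  · have := h (i - 1) (by simp at hi ⊢; linarith)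
    rw [pow_zero, one_mul, swap_swap] at this ⊢
    rw [e, intCoeff_X_mul]
    exact this

theorem isOneSided_of_eq {w : List Bool} (h : rankPoly (swap w) = rankPoly w) : IsOneSided w :=
  .inl fun i _ => by simp [h, intCoeff]

/-- Removing both ends and the whole initial run of `true` turns the length of that run into the
exponent, which is at least 1, so the induction hypothesis for right-heaviness applies to what is
left. -/
theorem isOneSided_of_ends (w : List Bool)
    (ih : ∀ v : List Bool, v.length < w.length → ∀ a, 1 ≤ a → IsRightHeavy v a) :
    IsOneSided (true :: (w ++ [false])) := by
  refine .inr fun i hi => ?_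
  rw [swap_swap, pow_zero, one_mul]
  rw [length_swap] at hi
  rcases eq_replicate_or_prefix true w with ⟨a, rfl⟩ | ⟨a, v, rfl⟩
  · have e := rankPoly_sub_swap_replicate (a + 1)
    rw [List.replicate_succ, List.cons_append] at e
    rw [e, intCoeff_X_mul]
    refine intCoeff_one_sub_X_pow ?_
    simp at hi ⊢
    omega
  · have e := rankPoly_sub_swap_ne (a + 1) v
    rw [List.replicate_succ, List.cons_append] at e
    simp only [Bool.not_true, List.append_assoc, List.cons_append] at hi ⊢
    rw [e, intCoeff_X_mul]
    -- The hypothesis is taken at the swapped word, since the power of `X` multiplies `rankPoly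
    -- (swap v)`.
    have := ih (QRational.swap v) (by simp; omega) (a + 1) (by omega) (i - 1)
      (by simp at hi ⊢; linarith)
    rwa [swap_swap] at this

theorem isOneSided_of_forall (w : List Bool)
    (ih : ∀ v : List Bool, v.length < w.length → IsOneSided v ∧ ∀ a, 1 ≤ a → IsRightHeavy v a) :
    IsOneSided w := by
  have hsing : ∀ x, rankPoly [x] = geom 3 := by
    intro x
    cases x
    exacts [rankPoly_replicate_false 1, rankPoly_replicate_true 1]
  match w, ih with
  | [], _ => exact isOneSided_of_eq rfl
  | x :: u, ih =>
    rcases List.eq_nil_or_concat' u with rfl | ⟨v, y, rfl⟩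
    · exact isOneSided_of_eq (by rw [swap_cons, swap_nil, hsing, hsing])
    · have ih' := fun u (hu : u.length < v.length) =>
        (ih u (by simp; omega)).2
      cases x <;> cases y
      · exact isOneSided_cons_concat _ (ih v (by simp)).1
      · refine IsOneSided.swap ?_
        simp only [swap_cons, swap_append, swap_nil, Bool.not_true, Bool.not_false]
        exact isOneSided_of_ends _ (by simpa using ih')
      · exact isOneSided_of_ends _ ih'
      · exact isOneSided_cons_concat _ (ih v (by simp)).1

/-- Right-heaviness of the swapped word, read backwards, is the comparison in the reflection about
(m + 1)/2. -/
theorem exists_mode_rankPoly {w : List Bool} (h : IsRightHeavy w 1) (h' : IsRightHeavy (swap w) 1)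
    (hs : IsOneSided w) : ∃ k : ℤ,
      (∀ i < k, intCoeff (rankPoly w) i ≤ intCoeff (rankPoly w) (i + 1)) ∧
      (∀ i, k ≤ i → intCoeff (rankPoly w) (i + 1) ≤ intCoeff (rankPoly w) i) := by
  rw [isRightHeavy_iff] at h h'
  unfold IsOneSided at hs
  rw [isRightHeavy_iff, isRightHeavy_iff] at hs
  simp only [length_swap, intCoeff_rankPoly_swap] at h' hs
  refine exists_mode (m := w.length + 1) (by simpa using h) (fun j l e hjl => ?_)
    (hs.imp (by simp) fun hs j l e hjl => ?_)
  · have := h' (w.length + 1 - l) (w.length + 1 - j) (by push_cast; omega) (by omega)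
    simpa using this
  · have := hs (w.length + 1 - l) (w.length + 1 - j) (by push_cast; omega) (by omega)
    simpa using this

theorem isOneSided_and_isRightHeavy (w : List Bool) :
    IsOneSided w ∧ ∀ a, 1 ≤ a → IsRightHeavy w a := by
  induction hn : w.length using Nat.strong_induction_on generalizing w with
  | _ n ih =>
  subst hn
  have hs := isOneSided_of_forall w fun v hv => ih _ hv v rfl
  have h := isRightHeavy_one w fun v hv => (ih _ hv v rfl).2
  have h' := isRightHeavy_one (swap w) fun v hv => (ih _ (by simpa using hv) v rfl).2
  obtain ⟨k, hup, hdown⟩ := exists_mode_rankPoly h h' hs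
  refine ⟨hs, fun a ha => isRightHeavy_iff.2 fun j l e hjl => ?_⟩
  -- Left of the mode k, monotonicity suffices. Otherwise r_j ≤ r_{m-1-j} by the case a = 1, and l ≤
  -- m - 1 - j lies in the decreasing part.
  rcases le_total l k with hl | hl
  · exact le_of_step_le hup hjl.le hl
  · exact (isRightHeavy_iff.1 h j (w.length - j) (by push_cast; ring) (by omega)).trans
      (le_of_le_step hdown (by omega) hl)

/-- Rank polynomials of fence posets are unimodal. -/
theorem isUnimodal_rankPoly (w : List Bool) : IsUnimodal (rankPoly w) := by
  obtain ⟨hs, h⟩ := isOneSided_and_isRightHeavy w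
  obtain ⟨k, hup, hdown⟩ :=
    exists_mode_rankPoly (h 1 le_rfl) ((isOneSided_and_isRightHeavy (swap w)).2 1 le_rfl) hs
  exact isUnimodal_of_intCoeff hup hdown

/-! ### Numerators and denominators attached to words. -/

theorem isUnimodal_one : IsUnimodal 1 :=
  isUnimodal_of_intCoeff (k := 0)
    (fun i hi => by simp only [intCoeff_one]; split_ifs <;> omega)
    (fun i hi => by simp only [intCoeff_one]; split_ifs <;> omega)

theorem isUnimodal_zero : IsUnimodal 0 :=
  ⟨0, fun _ _ _ _ _ => by simp, fun _ _ _ _ _ => by simp⟩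

/-- Nonnegativity handles the new constant term 0, which must not exceed its successor. -/
theorem IsUnimodal.X_mul {p : ℤ[X]} (h : IsUnimodal p) (h0 : ∀ n, 0 ≤ p.coeff n) :
    IsUnimodal (X * p) := by
  obtain ⟨k, hup, hdown⟩ := h
  refine ⟨k + 1, ?_, ?_⟩
  · refine monotoneOn_of_le_add_one Set.ordConnected_Iic fun i _ _ hi => ?_
    simp only [Set.mem_Iic] at hi
    cases i with
    | zero => rw [coeff_X_mul, coeff_X_mul_zero]; exact h0 0
    | succ i =>
      rw [coeff_X_mul, coeff_X_mul]
      exact hup (Set.mem_Iic.2 (by omega)) (Set.mem_Iic.2 (by omega)) (by omega)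
  · refine antitoneOn_of_add_one_le Set.ordConnected_Ici fun i _ hi _ => ?_
    simp only [Set.mem_Ici] at hi
    obtain ⟨i, rfl⟩ : ∃ j, i = j + 1 := ⟨i - 1, by omega⟩
    rw [coeff_X_mul, coeff_X_mul]
    exact hdown (Set.mem_Ici.2 (by omega)) (Set.mem_Ici.2 (by omega)) (by omega)

/-- The numerator of the image of `1` under the transformation given by a word. -/
def numPoly (w : List Bool) : ℤ[X] := wordMat w 0 0 + wordMat w 0 1

/-- The denominator of the image of `1` under the transformation given by a word. -/
def denPoly (w : List Bool) : ℤ[X] := wordMat w 1 0 + wordMat w 1 1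

theorem rankPoly_eq (w : List Bool) : rankPoly w = X * numPoly w + denPoly w := by
  rw [rankPoly, numPoly, denPoly]; ring

@[simp] theorem numPoly_nil : numPoly [] = 1 := by simp [numPoly, wordMat_nil]
@[simp] theorem denPoly_nil : denPoly [] = 1 := by simp [denPoly, wordMat_nil]

theorem numPoly_true (w : List Bool) : numPoly (true :: w) = X * numPoly w + denPoly w := by
  simp [numPoly, denPoly, wordMat_cons, step, Matrix.mul_apply, Fin.sum_univ_two]; ring

theorem denPoly_true (w : List Bool) : denPoly (true :: w) = denPoly w := by
  simp [denPoly, wordMat_cons, step, Matrix.mul_apply, Fin.sum_univ_two]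

theorem numPoly_false (w : List Bool) : numPoly (false :: w) = X * numPoly w := by
  simp [numPoly, wordMat_cons, step, Matrix.mul_apply, Fin.sum_univ_two]; ring

theorem denPoly_false (w : List Bool) : denPoly (false :: w) = X * numPoly w + denPoly w := by
  simp [numPoly, denPoly, wordMat_cons, step, Matrix.mul_apply, Fin.sum_univ_two]; ring

theorem coeff_numPoly_denPoly_nonneg (w : List Bool) :
    (∀ n, 0 ≤ (numPoly w).coeff n) ∧ ∀ n, 0 ≤ (denPoly w).coeff n := by
  induction w with
  | nil => constructor <;> intro n <;> simp [coeff_one] <;> split_ifs <;> simp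
  | cons x w ih =>
    obtain ⟨hn, hd⟩ := ih
    have hX : ∀ n, 0 ≤ (X * numPoly w).coeff n := fun n => by
      cases n <;> simp [hn]
    have hs : ∀ n, 0 ≤ (X * numPoly w + denPoly w).coeff n := fun n => by
      rw [coeff_add]; exact add_nonneg (hX n) (hd n)
    cases x
    · rw [numPoly_false, denPoly_false]; exact ⟨hX, hs⟩
    · rw [numPoly_true, denPoly_true]; exact ⟨hs, hd⟩

theorem coeff_zero_denPoly (w : List Bool) : (denPoly w).coeff 0 = 1 := by
  induction w with
  | nil => simp
  | cons x w ih => cases x <;> simp [denPoly_true, denPoly_false, ih]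

theorem isCoprime_X_of_coeff_zero {p : ℤ[X]} (h : p.coeff 0 = 1) : IsCoprime X p := by
  have := divX_mul_X_add p
  rw [h, map_one] at this
  exact ⟨-divX p, 1, by linear_combination -this⟩

/-- Each generator acts by a Euclidean step and a multiplication by `X`; the latter is harmless
because denominators have constant term 1. -/
theorem isCoprime_numPoly_denPoly (w : List Bool) : IsCoprime (numPoly w) (denPoly w) := by
  induction w with
  | nil => simpa using isCoprime_one_left
  | cons x w ih =>
    have h := (isCoprime_X_of_coeff_zero (coeff_zero_denPoly w)).mul_left ih
    cases x
    · rw [numPoly_false, denPoly_false]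
      simpa [add_comm] using h.add_mul_left_right 1
    · rw [numPoly_true, denPoly_true]
      simpa using h.add_mul_left_left 1

theorem denPoly_ne_zero (w : List Bool) : denPoly w ≠ 0 := fun h => by
  simpa [h] using coeff_zero_denPoly w

theorem isUnimodal_numPoly (w : List Bool) : IsUnimodal (numPoly w) := by
  induction w with
  | nil => simpa using isUnimodal_one
  | cons x w ih =>
    cases x
    · rw [numPoly_false]
      exact ih.X_mul (coeff_numPoly_denPoly_nonneg w).1
    · rw [numPoly_true, ← rankPoly_eq]
      exact isUnimodal_rankPoly w

theorem isUnimodal_denPoly (w : List Bool) : IsUnimodal (denPoly w) := by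
  induction w with
  | nil => simpa using isUnimodal_one
  | cons x w ih =>
    cases x
    · rw [denPoly_false, ← rankPoly_eq]
      exact isUnimodal_rankPoly w
    · rw [denPoly_true]
      exact ih

/-! ### From rational numbers to words, and reduced fractions. -/

/-- `[y / (1 + y)]_q = q [y]_q / (1 + q [y]_q)`. -/
theorem qRatFin_div_one_add {y : ℚ} (hy : 0 < y) :
    qRatFin (y / (1 + y)) * (q * qRatFin y + 1) = q * qRatFin y := by
  have hq := q_ne_zero
  have hpos : 0 < y / (1 + y) := by positivity
  obtain ⟨h0, h1⟩ := sOk_of_pos y hy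
  obtain ⟨h0', h1'⟩ := sOk_of_pos _ hpos
  have e : -1 / (y / (1 + y)) = -1 / y - 1 := by field_simp; ring
  have h2 := qRatFin_sub_one (-1 / y)
  rw [← e, h1, h1'] at h2
  field_simp at h2
  linear_combination -h2

theorem exists_qRatFin_eq {x : ℚ} (hx : 0 < x) : ∃ w : List Bool,
    qRatFin x = algebraMap ℤ[X] Zq (numPoly w) / algebraMap ℤ[X] Zq (denPoly w) := by
  -- Subtractive Euclidean algorithm on a pair that need not be coprime; it stops at a = b, the
  -- empty word.
  suffices h : ∀ n a b : ℕ, a + b = n → 0 < a → 0 < b → ∃ w : List Bool,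
      qRatFin (a / b) = algebraMap ℤ[X] Zq (numPoly w) / algebraMap ℤ[X] Zq (denPoly w) by
    obtain ⟨w, hw⟩ := h _ x.num.toNat x.den rfl (by have := Rat.num_pos.2 hx; omega) x.den_pos
    refine ⟨w, ?_⟩
    rwa [show ((x.num.toNat : ℕ) : ℚ) = (x.num : ℚ) by
      exact_mod_cast Int.toNat_of_nonneg (Rat.num_pos.2 hx).le, Rat.num_div_den] at hw
  intro n
  induction n using Nat.strong_induction_on with
  | _ n ih =>
  rintro a b rfl ha hb
  rcases lt_trichotomy a b with hab | rfl | hab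
  · obtain ⟨c, rfl⟩ := Nat.exists_eq_add_of_lt hab
    obtain ⟨w, hw⟩ := ih _ (by omega) a (c + 1) rfl ha (by omega)
    refine ⟨false :: w, ?_⟩
    have ha' : (0 : ℚ) < a := by exact_mod_cast ha
    have hy : (0 : ℚ) < (a : ℚ) / ((c + 1 : ℕ) : ℚ) := by positivity
    have key := qRatFin_div_one_add hy
    rw [show (a : ℚ) / ((c + 1 : ℕ) : ℚ) / (1 + (a : ℚ) / ((c + 1 : ℕ) : ℚ))
      = (a : ℚ) / ((a + c + 1 : ℕ) : ℚ) by push_cast; field_simp; ring, hw, q_eq] at key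
    have hd := RatFunc.algebraMap_ne_zero (denPoly_ne_zero w)
    have hd' := RatFunc.algebraMap_ne_zero (denPoly_ne_zero (false :: w))
    rw [eq_div_iff hd']
    field_simp at key
    rw [denPoly_false, numPoly_false, map_add, map_mul]
    exact key
  · refine ⟨[], ?_⟩
    have : (a : ℚ) ≠ 0 := by exact_mod_cast ha.ne'
    rw [div_self this, qRatFin_one]
    simp
  · obtain ⟨c, rfl⟩ := Nat.exists_eq_add_of_lt hab
    obtain ⟨w, hw⟩ := ih _ (by omega) (c + 1) b rfl (by omega) hb
    refine ⟨true :: w, ?_⟩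
    have hb' : (b : ℚ) ≠ 0 := by exact_mod_cast hb.ne'
    have hd := RatFunc.algebraMap_ne_zero (denPoly_ne_zero w)
    rw [show ((b + c + 1 : ℕ) : ℚ) / (b : ℚ) = ((c + 1 : ℕ) : ℚ) / (b : ℚ) + 1 by
      push_cast; field_simp; ring, qRatFin_add_one, hw, q_eq, numPoly_true, denPoly_true, map_add,
      map_mul]
    field_simp

theorem leadingCoeff_pos {p : ℤ[X]} (h : ∀ n, 0 ≤ p.coeff n) (hp : p ≠ 0) : 0 < p.leadingCoeff :=
  lt_of_le_of_ne (h _) (leadingCoeff_ne_zero.2 hp).symm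

/-- The reduced expression of an element of `ℤ(q)` is unique. -/
theorem IsReducedFraction.eq_of_isCoprime {N M N₀ M₀ : ℤ[X]}
    (h : IsReducedFraction
      ((algebraMap ℤ[X] Zq N₀ / algebraMap ℤ[X] Zq M₀ : Zq) : OnePoint Zq) N M)
    (hc : IsCoprime N₀ M₀) (hM₀ : 0 < M₀.leadingCoeff) : N = N₀ ∧ M = M₀ := by
  have hM : M ≠ 0 := fun h0 => OnePoint.coe_ne_infty _ (h.eq_infty h0)
  have hM0 : M₀ ≠ 0 := by rintro rfl; simp at hM₀
  have hpos : 0 < M.leadingCoeff := h.sign.resolve_right fun h' => hM h'.1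
  have e := OnePoint.coe_injective (h.eq_div hM)
  rw [div_eq_div_iff (RatFunc.algebraMap_ne_zero hM0) (RatFunc.algebraMap_ne_zero hM), ← map_mul,
    ← map_mul] at e
  replace e := RatFunc.algebraMap_injective ℤ e
  have d1 : M₀ ∣ M := hc.symm.isRelPrime.dvd_of_dvd_mul_left ⟨N, by rw [e]; ring⟩
  have d2 : M ∣ M₀ := h.isRelPrime.symm.dvd_of_dvd_mul_left ⟨N₀, by rw [← e]; ring⟩
  obtain ⟨u, hu⟩ := associated_of_dvd_dvd d1 d2
  obtain ⟨r, hr, hru⟩ := Polynomial.isUnit_iff.1 u.isUnit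
  have hMM : M = M₀ := by
    -- The units of ℤ[q] are ±1, and the sign of the leading coefficient excludes -1.
    rcases Int.isUnit_iff.1 hr with rfl | rfl
    · rw [← hu, ← hru]; simp
    · rw [← hu, ← hru] at hpos
      simp at hpos
      omega
  subst hMM
  exact ⟨(mul_right_cancel₀ hM e).symm, rfl⟩

end QRational

end

theorem theorem5p2 :
    (∀ (x : ℚ) (N M : ℤ[X]), QRational.IsReducedFraction (QRational.qRat (x : OnePoint ℚ)) N M →
      (0 ≤ x → QRational.IsUnimodal N) ∧
      (x < 0 → QRational.IsUnimodal (-N)) ∧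
      QRational.IsUnimodal M) ∧
    (∀ N M : ℤ[X], QRational.IsReducedFraction (QRational.qRat OnePoint.infty) N M →
      QRational.IsUnimodal N ∧ QRational.IsUnimodal M) := by
  open QRational in
  refine ⟨fun x N M h => ?_, fun N M h => ?_⟩
  · change IsReducedFraction ((qRatFin x : Zq) : OnePoint Zq) N M at h
    rcases lt_trichotomy x 0 with hx | rfl | hx
    · have hy : 0 < -1 / x := div_pos_of_neg_of_neg (by norm_num) hx
      obtain ⟨w, hw⟩ := exists_qRatFin_eq hy
      obtain ⟨h0, h1⟩ := sOk_of_pos _ hy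
      have hd := RatFunc.algebraMap_ne_zero (denPoly_ne_zero w)
      have hn : numPoly w ≠ 0 := fun hn => h0 (by rw [hw, hn]; simp)
      have hn' := RatFunc.algebraMap_ne_zero hn
      have hX := RatFunc.algebraMap_ne_zero (K := ℤ) X_ne_zero
      rw [show -1 / (-1 / x) = x by field_simp, hw] at h1
      -- For the word w of -1/x, this fraction is already reduced and correctly signed, so the roles
      -- of numerator and denominator are exchanged.
      have e : qRatFin x = algebraMap ℤ[X] Zq (-denPoly w) / algebraMap ℤ[X] Zq (X * numPoly w) := by
        rw [h1, q_eq, map_neg, map_mul]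
        field_simp
      rw [e] at h
      have hpos := (coeff_numPoly_denPoly_nonneg w).1
      obtain ⟨rfl, rfl⟩ := h.eq_of_isCoprime
        (((isCoprime_X_of_coeff_zero (coeff_zero_denPoly w)).mul_left
          (isCoprime_numPoly_denPoly w)).symm.neg_left)
        (leadingCoeff_pos (fun n => by cases n <;> simp [hpos]) (mul_ne_zero X_ne_zero hn))
      refine ⟨fun h => absurd h (not_le.2 hx), fun _ => ?_, (isUnimodal_numPoly w).X_mul hpos⟩
      rw [neg_neg]
      exact isUnimodal_denPoly w
    · rw [show qRatFin 0 = algebraMap ℤ[X] Zq 0 / algebraMap ℤ[X] Zq 1 by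
        rw [qRatFin_zero, map_zero, zero_div]] at h
      obtain ⟨rfl, rfl⟩ := h.eq_of_isCoprime isCoprime_one_right (by simp)
      exact ⟨fun _ => isUnimodal_zero, fun h => absurd h (lt_irrefl 0), isUnimodal_one⟩
    · obtain ⟨w, hw⟩ := exists_qRatFin_eq hx
      rw [hw] at h
      obtain ⟨rfl, rfl⟩ := h.eq_of_isCoprime (isCoprime_numPoly_denPoly w)
        (leadingCoeff_pos (coeff_numPoly_denPoly_nonneg w).2 (denPoly_ne_zero w))
      exact ⟨fun _ => isUnimodal_numPoly w, fun h => absurd h hx.not_gt, isUnimodal_denPoly w⟩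
  · have hM : M = 0 := by
      by_contra hM
      exact OnePoint.infty_ne_coe _ (h.eq_div hM)
    subst hM
    -- The zero polynomial has leading coefficient 0, so only the normalization 1/0 remains.
    obtain ⟨-, rfl⟩ := h.sign.resolve_left (by simp)
    exact ⟨isUnimodal_one, isUnimodal_zero⟩
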